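/- Let $G$ be a $t$-transmission regular complete multipartite graph with $m\ge 2$ parts, each of size $s\ge 2$; that is, $\operatorname{trs}(v)=\sum_{u} d_G(u,v)=t$ for every vertex $v$. Let $A^{\operatorname{trs}}_+(G)=\operatorname{diag}(\operatorname{trs}(G))+A(G)$, where $A(G)$ is the adjacency matrix and $\operatorname{diag}(\operatorname{trs}(G))$ is the diagonal matrix of the transmissions $\operatorname{trs}(v)$, and put $a=\gcd(m-1,\,2(s-1))$. Write $c\,\mathbf 1_{(k)}$ for the entry $c$ repeated $k$ times. Then the Smith normal form of $A^{\operatorname{trs}}_+(G)$ over $\mathbb Z$ is $$\operatorname{diag}\Bigl(\mathbf 1_{(m-1)},\ a,\ t\,\mathbf 1_{(ms-2m)},\ 2t,\ t(t-s)\,\mathbf 1_{(m-2)},\ \tfrac{(ms-1)\,t(t-s)}{a}\Bigr)\quad\text{if } m \text{ and } s \text{ are both even},$$ $$\operatorname{diag}\Bigl(\mathbf 1_{(m-1)},\ a,\ t\,\mathbf 1_{(ms-2m)},\ t,\ t(t-s)\,\mathbf 1_{(m-2)},\ \tfrac{2(ms-1)\,t(t-s)}{a}\Bigr)\quad\text{otherwise}.$$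 In particular, the last entry is an integer in each case. -/

import Mathlib

namespace SimpleGraph

variable {V : Type*} [Fintype V]

/-- The transmission of a vertex: the sum of its distances to all vertices. -/
noncomputable def transmission (G : SimpleGraph V) (v : V) : ℕ :=
  ∑ u, G.dist u v

/-- `G` is `t`-transmission regular: every vertex has transmission `t`. -/
def IsTransmissionRegular (G : SimpleGraph V) (t : ℕ) : Prop :=
  ∀ v, G.transmission v = t

/-- The signless adjacency-transmission matrix `diag(trs(G)) + A(G)`, with integer entries. -/
noncomputable def signlessTrsMatrix [DecidableEq V] (G : SimpleGraph V) [DecidableRel G.Adj] :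
    Matrix V V ℤ :=
  Matrix.diagonal (fun v => (G.transmission v : ℤ)) + G.adjMatrix ℤ

end SimpleGraph

/-- The square integer matrix `M` has Smith normal form `diag(d₁, …, dₙ)`, where `d` is the list
of the `dᵢ`: they are nonnegative integers, each divides the next, and `P * M * Q` is the diagonal
matrix with these entries for some unimodular integer matrices `P`, `Q`. The bijection `e` only
orders the index set of `M`, so that the diagonal entries can be listed. -/
def Matrix.HasSmithNormalForm {V : Type*} [Fintype V] [DecidableEq V]
    (M : Matrix V V ℤ) (d : List ℕ) : Prop :=
  d.IsChain (· ∣ ·) ∧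
    ∃ (e : V ≃ Fin d.length) (P Q : Matrix V V ℤ), IsUnit P.det ∧ IsUnit Q.det ∧
      P * M * Q = Matrix.diagonal (fun v => ((d.get (e v) : ℕ) : ℤ))

/-! Distinct vertices are at distance 1 across parts and 2 inside a part, so `t = ms + s - 2`, and
apart from `t` times the identity the matrix sees only the sums over parts. Hence `s - 2`
differences inside each part split off with factor `t`. Differences between parts then split off `m
- 2` blocks `(t-s, -1; 0, t)`, each equivalent to `diag(1, t(t-s))` by
`shearMap_equivalent_diagonal`.

A 4×4 block remains. An entry `-1` is a pivot (`quaternaryMap_equivalent_prod`). Writing `m-1 = an`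
and `2(s-1) = ar` gives `t = a(r+sn)` and a row of gcd `a` (`ternaryMap_equivalent_prod`). What is
left is `t` times `(r+sn, s; (t-s)n, -(t-s))`. Its first row has gcd `ε = gcd(s, r+sn)`, which also
divides `t-s`, so `binaryMap_equivalent_diagonal` yields `εt` and, from the determinant,
`2(ms-1)t(t-s)/(aε)`. Finally `ε` is 2 if `m` and `s` are even, and 1 otherwise
(`gcd_part_size_eq`). -/

/-- Two self-maps agree up to a linear change of coordinates in the source and another one in the
target. For linear maps of finite free `ℤ`-modules this is unimodular equivalence of matrices. -/
def UnimodularlyEquivalent {A B : Type*} [AddCommGroup A] [AddCommGroup B]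
    (f : A → A) (g : B → B) : Prop :=
  ∃ φ ψ : A ≃ₗ[ℤ] B, ∀ x, ψ (f x) = g (φ x)

namespace UnimodularlyEquivalent

variable {A B C D : Type*} [AddCommGroup A] [AddCommGroup B] [AddCommGroup C] [AddCommGroup D]

theorem refl (f : A → A) : UnimodularlyEquivalent f f :=
  ⟨LinearEquiv.refl ℤ A, LinearEquiv.refl ℤ A, fun _ => rfl⟩

theorem trans {f : A → A} {g : B → B} {h : C → C} (hfg : UnimodularlyEquivalent f g)
    (hgh : UnimodularlyEquivalent g h) : UnimodularlyEquivalent f h := by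
  obtain ⟨φ, ψ, h₁⟩ := hfg
  obtain ⟨φ', ψ', h₂⟩ := hgh
  exact ⟨φ.trans φ', ψ.trans ψ', fun x => by simp [h₁, h₂]⟩

theorem prodMap {f : A → A} {g : B → B} {f' : C → C} {g' : D → D}
    (h : UnimodularlyEquivalent f g) (h' : UnimodularlyEquivalent f' g') :
    UnimodularlyEquivalent (Prod.map f f') (Prod.map g g') := by
  obtain ⟨φ, ψ, h₁⟩ := h
  obtain ⟨φ', ψ', h₂⟩ := h'
  exact ⟨φ.prodCongr φ', ψ.prodCongr ψ', fun x => by simp [h₁, h₂]⟩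

end UnimodularlyEquivalent

/-! ### Splitting by differences -/

/-- Coordinates on `A ^ (k + 2)`: the first entry, the sum of the differences of all entries with
the first one, and the differences of the last `k` entries with the first one. -/
def differenceCoordinates (A : Type*) [AddCommGroup A] (k : ℕ) :
    (Fin (k + 2) → A) ≃ₗ[ℤ] A × A × (Fin k → A) where
  toFun x := (x 0, ∑ j, (x j - x 0), fun j => x j.succ.succ - x 0)
  -- The difference `x 1 - x 0` has coefficient one in the sum of differences, so that sum can
  -- replace it in a basis.
  invFun y := Fin.cons y.1 (Fin.cons (y.1 + y.2.1 - ∑ j, y.2.2 j) fun j => y.1 + y.2.2 j)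
  map_add' x y := by
    ext j
    · simp
    · simp only [Pi.add_apply, Prod.fst_add, Prod.snd_add, ← Finset.sum_add_distrib]
      exact Finset.sum_congr rfl fun _ _ => by abel
    · simp only [Pi.add_apply, Prod.snd_add]
      abel
  map_smul' c x := by
    ext j
    · simp
    · simp [Finset.smul_sum, smul_sub, smul_comm _ c]
    · simp [smul_sub]
  left_inv x := by
    ext j
    refine Fin.cases ?_ (fun j => Fin.cases ?_ (fun j => ?_) j) j
    · simp
    · simp [Fin.sum_univ_succ]
      module
    · simp
  right_inv y := by
    obtain ⟨z, P, p⟩ := y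
    ext j
    · simp
    · simp [Fin.sum_univ_succ, Finset.sum_add_distrib]
      module
    · simp

/-- Coordinates on the pairs of vectors of length `l + 2`. -/
def pairDifferenceCoordinates (l : ℕ) :
    ((Fin (l + 2) → ℤ) × (Fin (l + 2) → ℤ)) ≃ₗ[ℤ]
      (ℤ × ℤ × ℤ × ℤ) × ((Fin l → ℤ) × (Fin l → ℤ)) :=
  ((differenceCoordinates ℤ l).prodCongr (differenceCoordinates ℤ l)).trans
    { toFun := fun y => ((y.1.1, y.1.2.1, y.2.1, y.2.2.1), (y.1.2.2, y.2.2.2))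
      invFun := fun y => ((y.1.1, y.1.2.1, y.2.1), (y.1.2.2.1, y.1.2.2.2, y.2.2))
      map_add' := fun _ _ => rfl
      map_smul' := fun _ _ => rfl
      left_inv := fun _ => rfl
      right_inv := fun _ => rfl }

/-- The action of `t + (J - I) ⊗ J` on arrays, the first index being the place inside a part. -/
def multipartiteMap (k m : ℕ) (t : ℤ) (x : Fin k → Fin m → ℤ) : Fin k → Fin m → ℤ :=
  fun j i => t * x j i + ((∑ i', ∑ j', x j' i') - ∑ j', x j' i)

theorem multipartiteMap_equivalent_prod (k m : ℕ) (t : ℤ) :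
    UnimodularlyEquivalent (multipartiteMap (k + 2) m t)
      (Prod.map
        (fun y : (Fin m → ℤ) × (Fin m → ℤ) =>
          ((fun i => t * y.1 i + ((∑ i', ((k + 2) * y.1 i' + y.2 i')) - ((k + 2) * y.1 i + y.2 i)),
            fun i => t * y.2 i) : (Fin m → ℤ) × (Fin m → ℤ)))
        (fun p : Fin k → Fin m → ℤ => fun j i => t * p j i)) := by
  let e := (differenceCoordinates (Fin m → ℤ) k).trans
    { toFun := fun y => ((y.1, y.2.1), y.2.2)
      invFun := fun y => (y.1.1, y.1.2, y.2)
      map_add' := fun _ _ => rfl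
      map_smul' := fun _ _ => rfl
      left_inv := fun _ => rfl
      right_inv := fun _ => rfl :
      ((Fin m → ℤ) × (Fin m → ℤ) × (Fin k → Fin m → ℤ)) ≃ₗ[ℤ]
        ((Fin m → ℤ) × (Fin m → ℤ)) × (Fin k → Fin m → ℤ) }
  refine ⟨e, e, fun x => ?_⟩
  have hsum : ∀ i, ∑ j, x j i = (k + 2) * x 0 i + ∑ j, (x j i - x 0 i) := fun i => by
    simp
  ext j
  · simp only [e, differenceCoordinates, multipartiteMap, hsum, LinearEquiv.trans_apply,
      LinearEquiv.coe_mk, LinearMap.coe_mk, AddHom.coe_mk, Prod.map_apply, Finset.sum_apply,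
      Pi.sub_apply]
  · simp only [e, differenceCoordinates, multipartiteMap, LinearEquiv.trans_apply,
      LinearEquiv.coe_mk, LinearMap.coe_mk, AddHom.coe_mk, Prod.map_apply, Finset.sum_apply,
      Pi.sub_apply, Finset.mul_sum]
    exact Finset.sum_congr rfl fun _ _ => by ring
  · simp [e, differenceCoordinates, multipartiteMap]
    ring

/-- The sum over all parts is the same in every component, so it cancels in differences. -/
theorem pairMap_equivalent_prod (l : ℕ) (s t : ℤ) :
    UnimodularlyEquivalent
      (fun y : (Fin (l + 2) → ℤ) × (Fin (l + 2) → ℤ) =>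
        ((fun i => t * y.1 i + ((∑ i', (s * y.1 i' + y.2 i')) - (s * y.1 i + y.2 i)),
          fun i => t * y.2 i) : (Fin (l + 2) → ℤ) × (Fin (l + 2) → ℤ)))
      (Prod.map
        (fun w : ℤ × ℤ × ℤ × ℤ =>
          ((t + (l + 1) * s) * w.1 + s * w.2.1 + (l + 1) * w.2.2.1 + w.2.2.2,
            (t - s) * w.2.1 - w.2.2.2, t * w.2.2.1, t * w.2.2.2))
        (fun u : (Fin l → ℤ) × (Fin l → ℤ) =>
          ((fun i => (t - s) * u.1 i - u.2 i, fun i => t * u.2 i) :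
            (Fin l → ℤ) × (Fin l → ℤ)))) := by
  refine ⟨pairDifferenceCoordinates l, pairDifferenceCoordinates l, fun y => ?_⟩
  obtain ⟨Z, P⟩ := y
  have hZ : ∑ j, Z j = (l + 2) * Z 0 + ∑ j, (Z j - Z 0) := by
    simp
  have hP : ∑ j, P j = (l + 2) * P 0 + ∑ j, (P j - P 0) := by
    simp
  have hdiff : ∑ j, ((t * Z j + ((∑ i', (s * Z i' + P i')) - (s * Z j + P j))) -
      (t * Z 0 + ((∑ i', (s * Z i' + P i')) - (s * Z 0 + P 0)))) =
      (t - s) * ∑ j, (Z j - Z 0) - ∑ j, (P j - P 0) := by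
    rw [Finset.mul_sum, ← Finset.sum_sub_distrib]
    exact Finset.sum_congr rfl fun _ _ => by ring
  ext j
  · simp only [pairDifferenceCoordinates, differenceCoordinates, LinearEquiv.trans_apply,
      LinearEquiv.prodCongr_apply, LinearEquiv.coe_mk, LinearMap.coe_mk, AddHom.coe_mk,
      Prod.map_apply]
    rw [Finset.sum_add_distrib, ← Finset.mul_sum, hZ, hP]
    ring
  · exact hdiff
  · rfl
  · simp [pairDifferenceCoordinates, differenceCoordinates, Finset.mul_sum, mul_sub]
    ring
  · simp [pairDifferenceCoordinates, differenceCoordinates]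
    ring
  · simp [pairDifferenceCoordinates, differenceCoordinates]
    ring

/-! ### Diagonalizing the small blocks -/

theorem shearMap_equivalent_diagonal (l : ℕ) (d t : ℤ) :
    UnimodularlyEquivalent
      (fun u : (Fin l → ℤ) × (Fin l → ℤ) =>
        ((fun i => d * u.1 i - u.2 i, fun i => t * u.2 i) : (Fin l → ℤ) × (Fin l → ℤ)))
      (fun u : (Fin l → ℤ) × (Fin l → ℤ) =>
        ((u.1, fun i => t * d * u.2 i) : (Fin l → ℤ) × (Fin l → ℤ))) := by
  let φ : ((Fin l → ℤ) × (Fin l → ℤ)) ≃ₗ[ℤ] (Fin l → ℤ) × (Fin l → ℤ) :=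
    { toFun := fun u => (d • u.1 - u.2, u.1)
      invFun := fun u => (u.2, d • u.2 - u.1)
      map_add' := fun x y => by
        ext <;> simp <;> ring
      map_smul' := fun c x => by
        ext <;> simp <;> ring
      left_inv := fun x => by ext <;> simp
      right_inv := fun x => by ext <;> simp }
  let ψ : ((Fin l → ℤ) × (Fin l → ℤ)) ≃ₗ[ℤ] (Fin l → ℤ) × (Fin l → ℤ) :=
    { toFun := fun u => (u.1, u.2 + t • u.1)
      invFun := fun u => (u.1, u.2 - t • u.1)
      map_add' := fun x y => by
        ext <;> simp <;> ring
      map_smul' := fun c x => by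
        ext <;> simp <;> ring
      left_inv := fun x => by ext <;> simp
      right_inv := fun x => by ext <;> simp }
  refine ⟨φ, ψ, fun u => ?_⟩
  ext i <;> simp [φ, ψ]
  ring

/-- By `h` the first row over `g` is primitive, hence part of a basis; clearing the second row with
it leaves the determinant up to sign. -/
theorem binaryMap_equivalent_diagonal {p q p' q' u v : ℤ} (g : ℤ) (h : u * p + v * q = 1) :
    UnimodularlyEquivalent
      (fun w : ℤ × ℤ => (g * (p * w.1 + q * w.2), g * (p' * w.1 + q' * w.2)))
      (fun w : ℤ × ℤ => (g * w.1, g * (q * p' - p * q') * w.2)) := by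
  let φ : (ℤ × ℤ) ≃ₗ[ℤ] ℤ × ℤ :=
    { toFun := fun w => (p * w.1 + q * w.2, u * w.2 - v * w.1)
      invFun := fun w => (u * w.1 - q * w.2, v * w.1 + p * w.2)
      map_add' := fun x y => by
        ext <;> simp <;> ring
      map_smul' := fun c x => by
        ext <;> simp <;> ring
      left_inv := fun x => by
        ext
        · linear_combination x.1 * h
        · linear_combination x.2 * h
      right_inv := fun x => by
        ext
        · linear_combination x.1 * h
        · linear_combination x.2 * h }
  let ψ : (ℤ × ℤ) ≃ₗ[ℤ] ℤ × ℤ :=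
    { toFun := fun w => (w.1, (p' * u + q' * v) * w.1 - w.2)
      invFun := fun w => (w.1, (p' * u + q' * v) * w.1 - w.2)
      map_add' := fun x y => by
        ext <;> simp <;> ring
      map_smul' := fun c x => by
        ext <;> simp <;> ring
      left_inv := fun x => by ext <;> simp
      right_inv := fun x => by ext <;> simp }
  refine ⟨φ, ψ, fun w => ?_⟩
  ext
  · rfl
  · change (p' * u + q' * v) * (g * (p * w.1 + q * w.2)) - g * (p' * w.1 + q' * w.2) =
      g * (q * p' - p * q') * (u * w.2 - v * w.1)
    linear_combination (g * p' * w.1 + g * q' * w.2) * h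

theorem quaternaryMap_equivalent_prod (s t n : ℤ) :
    UnimodularlyEquivalent
      (fun w : ℤ × ℤ × ℤ × ℤ =>
        ((t + n * s) * w.1 + s * w.2.1 + n * w.2.2.1 + w.2.2.2,
          (t - s) * w.2.1 - w.2.2.2, t * w.2.2.1, t * w.2.2.2))
      (Prod.map (fun q : ℤ => q) (fun w : ℤ × ℤ × ℤ =>
        ((t + n * s) * w.1 + t * w.2.1 + n * w.2.2, t * w.2.2, t * (t - s) * w.2.1))) := by
  let φ : (ℤ × ℤ × ℤ × ℤ) ≃ₗ[ℤ] ℤ × ℤ × ℤ × ℤ :=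
    { toFun := fun w => ((t - s) * w.2.1 - w.2.2.2, w.1, w.2.1, w.2.2.1)
      invFun := fun w => (w.2.1, w.2.2.1, w.2.2.2, (t - s) * w.2.2.1 - w.1)
      map_add' := fun x y => by
        ext <;> simp <;> ring
      map_smul' := fun c x => by
        ext <;> simp <;> ring
      left_inv := fun x => by ext <;> simp
      right_inv := fun x => by ext <;> simp }
  -- Adding the pivot output to the first output cancels the last variable and turns the coefficient
  -- `s` into `t`.
  let ψ : (ℤ × ℤ × ℤ × ℤ) ≃ₗ[ℤ] ℤ × ℤ × ℤ × ℤ :=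
    { toFun := fun w => (w.2.1, w.1 + w.2.1, w.2.2.1, w.2.2.2 + t * w.2.1)
      invFun := fun w => (w.2.1 - w.1, w.1, w.2.2.1, w.2.2.2 - t * w.1)
      map_add' := fun x y => by
        ext <;> simp <;> ring
      map_smul' := fun c x => by
        ext <;> simp <;> ring
      left_inv := fun x => by ext <;> simp
      right_inv := fun x => by ext <;> simp }
  refine ⟨φ, ψ, fun w => ?_⟩
  ext <;> simp [φ, ψ] <;> ring

/-- The first output is `a` times a form with coprime coefficients `n` and `r` in two new variables,
so that form is a coordinate. The other outputs are multiples of `t`, hence of `a`, and can be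
cleared. -/
theorem ternaryMap_equivalent_prod {s t a n r x y : ℤ} (h : x * n + y * r = 1)
    (ht : t = a * (r + s * n)) :
    UnimodularlyEquivalent
      (fun w : ℤ × ℤ × ℤ =>
        ((t + a * n * s) * w.1 + t * w.2.1 + a * n * w.2.2, t * w.2.2, t * (t - s) * w.2.1))
      (Prod.map (fun q : ℤ => a * q) (fun w : ℤ × ℤ =>
        (t * ((r + s * n) * w.1 + s * w.2), t * ((t - s) * n * w.1 + -(t - s) * w.2)))) := by
  let φ : (ℤ × ℤ × ℤ) ≃ₗ[ℤ] ℤ × ℤ × ℤ :=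
    { toFun := fun w =>
        (n * (w.2.2 + s * w.1 + s * (w.2.1 + w.1)) + r * (w.2.1 + w.1),
          x * (w.2.1 + w.1) - y * (w.2.2 + s * w.1 + s * (w.2.1 + w.1)), w.1)
      invFun := fun w =>
        (w.2.2, y * w.1 + n * w.2.1 - w.2.2,
          x * w.1 - r * w.2.1 - s * w.2.2 - s * (y * w.1 + n * w.2.1))
      map_add' := fun x y => by
        ext <;> simp <;> ring
      map_smul' := fun c x => by
        ext <;> simp <;> ring
      left_inv := fun w => by
        ext
        · rfl
        · linear_combination (w.2.1 + w.1) * h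
        · linear_combination (w.2.2 + s * w.1) * h
      right_inv := fun w => by
        ext
        · linear_combination w.1 * h
        · linear_combination w.2.1 * h
        · rfl }
  let ψ : (ℤ × ℤ × ℤ) ≃ₗ[ℤ] ℤ × ℤ × ℤ :=
    { toFun := fun w =>
        (w.1, (r + s * n) * (x - s * y) * w.1 - w.2.1, w.2.2 - (r + s * n) * (t - s) * y * w.1)
      invFun := fun w =>
        (w.1, (r + s * n) * (x - s * y) * w.1 - w.2.1, w.2.2 + (r + s * n) * (t - s) * y * w.1)
      map_add' := fun x y => by
        ext <;> simp <;> ring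
      map_smul' := fun c x => by
        ext <;> simp <;> ring
      left_inv := fun x => by ext <;> simp
      right_inv := fun x => by ext <;> simp }
  refine ⟨φ, ψ, fun w => ?_⟩
  obtain ⟨z, U, P⟩ := w
  subst ht
  ext
  · simp [φ, ψ]
    ring
  · simp [φ, ψ]
    linear_combination (a * (r + s * n) * (P + s * z)) * h
  · simp [φ, ψ]
    linear_combination -(a * (r + s * n) * (a * (r + s * n) - s) * (U + z)) * h

/-! ### From a diagonal map to the Smith normal form -/

/-- The multiset of the values of `c`, listed in some order, is `d`. -/
def IsListing {W : Type*} (c : W → ℕ) (d : List ℕ) : Prop :=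
  ∃ e : W ≃ Fin d.length, ∀ w, d.get (e w) = c w

namespace IsListing

theorem sumElim {W W' : Type*} {c : W → ℕ} {c' : W' → ℕ} {d d' : List ℕ}
    (h : IsListing c d) (h' : IsListing c' d') : IsListing (Sum.elim c c') (d ++ d') := by
  obtain ⟨e, he⟩ := h
  obtain ⟨e', he'⟩ := h'
  refine ⟨((e.sumCongr e').trans finSumFinEquiv).trans (finCongr (by simp)), ?_⟩
  rintro (w | w)
  · simp [← he]
  · simp [← he']

theorem const {W : Type*} [Fintype W] {n : ℕ} (h : Fintype.card W = n) (a : ℕ) :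
    IsListing (fun _ : W => a) (List.replicate n a) :=
  ⟨(Fintype.equivFinOfCardEq h).trans (finCongr (by simp)), by simp⟩

theorem unit (a : ℕ) : IsListing (fun _ : Unit => a) [a] :=
  const (n := 1) rfl a

end IsListing

theorem Matrix.HasSmithNormalForm.of_unimodularlyEquivalent {V W : Type*} [Fintype V]
    [DecidableEq V] {M : Matrix V V ℤ} {c : W → ℕ} {d : List ℕ} (hd : d.IsChain (· ∣ ·))
    (hc : IsListing c d) (h : UnimodularlyEquivalent M.mulVec (fun (x : W → ℤ) w => c w * x w)) :
    M.HasSmithNormalForm d := by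
  obtain ⟨e, he⟩ := hc
  obtain ⟨φ, ψ, h⟩ := h
  have : Fintype W := Fintype.ofEquiv _ e.symm
  have hcard : Fintype.card V = Fintype.card W := by
    simpa using φ.finrank_eq
  -- Any bijection will do: `φ'` and `ψ'` absorb the relabelling.
  let σ : V ≃ W := Fintype.equivOfCardEq hcard
  let φ' : (V → ℤ) ≃ₗ[ℤ] (V → ℤ) := φ.trans (LinearEquiv.funCongrLeft ℤ ℤ σ)
  let ψ' : (V → ℤ) ≃ₗ[ℤ] (V → ℤ) := ψ.trans (LinearEquiv.funCongrLeft ℤ ℤ σ)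
  refine ⟨hd, σ.trans e, LinearMap.toMatrix' ψ'.toLinearMap,
    LinearMap.toMatrix' φ'.symm.toLinearMap, ?_, ?_, ?_⟩
  · rw [LinearMap.det_toMatrix']
    exact ψ'.isUnit_det'
  · rw [LinearMap.det_toMatrix']
    exact φ'.symm.isUnit_det'
  · apply Matrix.toLin'.injective
    ext1 x
    rw [Matrix.toLin'_mul, Matrix.toLin'_mul, Matrix.toLin'_toMatrix', Matrix.toLin'_toMatrix']
    ext v
    have hg : ∀ w, d[(e w : ℕ)] = c w := he
    simp [φ', ψ', h, Matrix.mulVec_diagonal, LinearEquiv.funCongrLeft, hg]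

/-! ### Distances and the matrix of the graph -/

namespace SimpleGraph

variable {V : Type*} {G : SimpleGraph V} {m s : ℕ}

theorem dist_eq_of_iso_completeEquipartiteGraph [DecidableEq V] (hm : 2 ≤ m)
    (φ : G ≃g completeEquipartiteGraph m s) (u v : V) :
    G.dist u v = if (φ u).1 = (φ v).1 then if u = v then 0 else 2 else 1 := by
  have hadj : ∀ u v, G.Adj u v ↔ (φ u).1 ≠ (φ v).1 := fun u v => by
    rw [← φ.map_adj_iff, completeEquipartiteGraph_adj]
  split_ifs with h huv
  · simp [huv]
  · have : Nontrivial (Fin m) := Fin.nontrivial_iff_two_le.2 hm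
    obtain ⟨k, hk⟩ := exists_ne (φ u).1
    have h₁ : G.Adj u (φ.symm (k, (φ u).2)) := (hadj _ _).2 (by simpa using hk.symm)
    have h₂ : G.Adj (φ.symm (k, (φ u).2)) v := (hadj _ _).2 (by simpa [h] using hk)
    let p : G.Walk u v := .cons h₁ (.cons h₂ .nil)
    exact le_antisymm (G.dist_le p)
      (p.reachable.one_lt_dist_of_ne_of_not_adj huv (by simp [hadj, h]))
  · exact dist_eq_one_iff_adj.2 ((hadj u v).2 h)

theorem transmission_add_two_of_iso_completeEquipartiteGraph [Fintype V] (hm : 2 ≤ m)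
    (φ : G ≃g completeEquipartiteGraph m s) (v : V) :
    G.transmission v + 2 = m * s + s := by
  classical
  -- The correction at `u = v` makes the distance depend only on whether the parts agree.
  have h : ∀ u, G.dist u v + (if u = v then 2 else 0) = 1 + if (φ u).1 = (φ v).1 then 1 else 0 := by
    intro u
    rw [dist_eq_of_iso_completeEquipartiteGraph hm φ]
    by_cases huv : u = v
    · simp [huv]
    · by_cases h' : (φ u).1 = (φ v).1 <;> simp [huv, h']
  have hφ : (∑ u, if (φ u).1 = (φ v).1 then 1 else 0) =
      ∑ w : Fin m × Fin s, if w.1 = (φ v).1 then 1 else 0 :=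
    φ.toEquiv.sum_comp fun w => if w.1 = (φ v).1 then 1 else 0
  have hsum := Finset.sum_congr (rfl : (Finset.univ : Finset V) = _) fun u _ => h u
  rw [Finset.sum_add_distrib, Finset.sum_add_distrib, Finset.sum_ite_eq' Finset.univ v,
    if_pos (Finset.mem_univ v), hφ, Fintype.sum_prod_type_right] at hsum
  have hcard : Fintype.card V = m * s := by simpa using Fintype.card_congr φ.toEquiv
  simpa [hcard, transmission] using hsum

theorem signlessTrsMatrix_equivalent_multipartiteMap [Fintype V] [DecidableEq V] [DecidableRel G.Adj] {t : ℕ}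
    (φ : G ≃g completeEquipartiteGraph m s) (ht : G.IsTransmissionRegular t) :
    UnimodularlyEquivalent G.signlessTrsMatrix.mulVec (multipartiteMap s m t) := by
  let e : (V → ℤ) ≃ₗ[ℤ] (Fin s → Fin m → ℤ) :=
    { toFun := fun x j i => x (φ.symm (i, j))
      invFun := fun y v => y (φ v).2 (φ v).1
      map_add' := fun _ _ => rfl
      map_smul' := fun _ _ => rfl
      left_inv := fun x => by ext; simp
      right_inv := fun y => by ext; simp }
  refine ⟨e, e, fun x => ?_⟩
  ext j i
  have hadj : ∀ i' j', G.Adj (φ.symm (i, j)) (φ.symm (i', j')) ↔ i ≠ i' := fun i' j' => by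
    rw [φ.symm.map_adj_iff, completeEquipartiteGraph_adj]
  have hsum : (G.adjMatrix ℤ).mulVec x (φ.symm (i, j)) =
      ∑ i', ∑ j', if i = i' then 0 else x (φ.symm (i', j')) := by
    rw [← Fintype.sum_prod_type' (f := fun i' j' => if i = i' then 0 else x (φ.symm (i', j')))]
    simp only [Matrix.mulVec, dotProduct]
    refine (φ.toEquiv.symm.sum_comp _).symm.trans (Finset.sum_congr rfl fun w _ => ?_)
    obtain ⟨i', j'⟩ := w
    change G.adjMatrix ℤ _ (φ.symm (i', j')) * x (φ.symm (i', j')) = _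
    simp only [adjMatrix_apply, hadj]
    by_cases h : i = i' <;> simp [h]
  change (G.signlessTrsMatrix.mulVec x) (φ.symm (i, j)) = t * x (φ.symm (i, j)) +
    ((∑ i', ∑ j', x (φ.symm (i', j'))) - ∑ j', x (φ.symm (i, j')))
  rw [signlessTrsMatrix, Matrix.add_mulVec, Pi.add_apply, Matrix.mulVec_diagonal, ht, hsum]
  congr 1
  rw [eq_sub_iff_add_eq, ← Fintype.sum_ite_eq i fun i' => ∑ j', x (φ.symm (i', j')),
    ← Finset.sum_add_distrib]
  refine Finset.sum_congr rfl fun i' _ => ?_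
  by_cases h : i = i' <;> simp [h]

end SimpleGraph

/-! ### Assembling the invariant factors -/

/-- The index set of the diagonal form, in the order of the invariant factors. -/
abbrev InvariantFactorIndex (k l : ℕ) : Type :=
  ((((Fin l ⊕ Unit) ⊕ Unit) ⊕ (Fin k × Fin (l + 2))) ⊕ Unit) ⊕ Fin l ⊕ Unit

/-- The labelling of the index set by `1`, `a`, `t`, `b`, `c` and `d`. -/
def invariantFactorLabel (k l a t b c d : ℕ) : InvariantFactorIndex k l → ℕ :=
  Sum.elim (Sum.elim (Sum.elim (Sum.elim (Sum.elim (fun _ => 1) fun _ => 1) fun _ => a) fun _ => t)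
    fun _ => b) (Sum.elim (fun _ => c) fun _ => d)

theorem isListing_invariantFactorLabel (k l a t b c d : ℕ) :
    IsListing (invariantFactorLabel k l a t b c d)
      (List.replicate (l + 1) 1 ++ [a] ++ List.replicate (k * (l + 2)) t ++ [b] ++
        List.replicate l c ++ [d]) := by
  rw [List.append_assoc _ (List.replicate l c), List.replicate_add]
  exact (((((IsListing.const (by simp) 1).sumElim (.const (by simp) 1)).sumElim (.unit a)).sumElim
    (.const (by simp) t)).sumElim (.unit b)).sumElim ((IsListing.const (by simp) c).sumElim (.unit d))

theorem isChain_dvd_invariantFactors {k l a t b c d : ℕ} (hat : a ∣ t) (htb : t ∣ b)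
    (hbc : b ∣ c) (hcd : c ∣ d) :
    (List.replicate (l + 1) 1 ++ [a] ++ List.replicate (k * (l + 2)) t ++ [b] ++
      List.replicate l c ++ [d]).IsChain (· ∣ ·) := by
  have hab := hat.trans htb
  have hac := hab.trans hbc
  have htc := htb.trans hbc
  have had := hac.trans hcd
  have htd := htc.trans hcd
  have hbd := hbc.trans hcd
  -- By transitivity all pairs may be compared, which also covers empty blocks (`k = 0` or `l = 0`).
  rw [List.isChain_iff_pairwise]
  simp only [List.pairwise_append, List.pairwise_replicate, List.pairwise_singleton,
    List.mem_append, List.mem_replicate, List.mem_singleton]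
  grind [one_dvd, dvd_refl]

/-- The components of a vector over `InvariantFactorIndex k l`, grouped by the blocks of the
multipartite matrix. -/
def blockCoordinates (k l : ℕ) :
    (((ℤ × ℤ × ℤ × ℤ) × ((Fin l → ℤ) × (Fin l → ℤ))) × (Fin k → Fin (l + 2) → ℤ)) ≃ₗ[ℤ]
      (InvariantFactorIndex k l → ℤ) where
  toFun y := Sum.elim (Sum.elim (Sum.elim (Sum.elim (Sum.elim y.1.2.1 fun _ => y.1.1.1)
    fun _ => y.1.1.2.1) fun p => y.2 p.1 p.2) fun _ => y.1.1.2.2.1)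
    (Sum.elim y.1.2.2 fun _ => y.1.1.2.2.2)
  invFun x := (((x (.inl (.inl (.inl (.inl (.inr ()))))), x (.inl (.inl (.inl (.inr ())))),
    x (.inl (.inr ())), x (.inr (.inr ()))),
    (fun i => x (.inl (.inl (.inl (.inl (.inl i))))), fun i => x (.inr (.inl i)))),
    fun j i => x (.inl (.inl (.inr (j, i)))))
  map_add' x y := by ext (((((_ | _) | _) | _) | _) | _ | _) <;> rfl
  map_smul' c x := by ext (((((_ | _) | _) | _) | _) | _ | _) <;> rfl
  left_inv _ := rfl
  right_inv x := by ext (((((_ | _) | _) | _) | _) | _ | _) <;> rfl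

/-- Here `a * n' = l + 1` and `a * r' = 2 * (k + 1)` with `n'` and `r'` coprime, and `ε * s'` and
`ε * q` are the part size and `r' + (k + 2) * n'`, with `s'` and `q` coprime. -/
theorem multipartiteMap_equivalent_diagonal {k l t a n' r' ε s' q : ℕ} (hn : a * n' = l + 1)
    (hr : a * r' = 2 * (k + 1)) (hnr : n'.Coprime r') (hs : ε * s' = k + 2)
    (hq : ε * q = r' + (k + 2) * n') (hsq : s'.Coprime q)
    (ht : t = (l + 1) * (k + 2) + 2 * (k + 1)) :
    UnimodularlyEquivalent (multipartiteMap (k + 2) (l + 2) t)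
      (fun (x : InvariantFactorIndex k l → ℤ) i =>
        invariantFactorLabel k l a t (ε * t) (t * (t - (k + 2)))
        (t * (t - (k + 2)) * (s' * n' + q)) i * x i) := by
  obtain ⟨x, y, hxy⟩ := Nat.isCoprime_iff_coprime.2 hnr
  obtain ⟨v, u, huv⟩ := Nat.isCoprime_iff_coprime.2 hsq
  have hτ : ((t - (k + 2) : ℕ) : ℤ) = t - (k + 2) := by
    rw [Nat.cast_sub (by rw [ht]; nlinarith)]
    push_cast
    rfl
  zify at hn hr hs hq ht
  have hta : (t : ℤ) = a * (r' + (k + 2) * n') := by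
    linear_combination ht - hr - (k + 2) * hn
  -- Thus `ε` divides the second row of the 2×2 block as well.
  have hw : (t : ℤ) - (k + 2) = ε * (a * q - s') := by
    linear_combination hta + hs - a * hq
  have hpart := pairMap_equivalent_prod l (k + 2) t
  have hshear := shearMap_equivalent_diagonal l (t - (k + 2)) t
  have hquat := quaternaryMap_equivalent_prod (k + 2) t (l + 1)
  have htern := ternaryMap_equivalent_prod hxy hta
  have hbin := binaryMap_equivalent_diagonal (u := u) (v := v) (p := q) (q := s') (p' := (a * q - s') * n')
    (q' := - (a * q - s')) (ε * t) (by linear_combination huv)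
  have hbin' : (fun w : ℤ × ℤ => (ε * t * (q * w.1 + s' * w.2),
      ε * t * ((a * q - s') * n' * w.1 + -(a * q - s') * w.2))) =
      fun w : ℤ × ℤ => (t * ((r' + (k + 2) * n') * w.1 + (k + 2) * w.2),
        t * ((t - (k + 2)) * n' * w.1 + -(t - (k + 2)) * w.2)) := by
    funext w
    ext
    · linear_combination t * w.1 * hq + t * w.2 * hs
    · linear_combination -(t * (n' * w.1 - w.2)) * hw
  rw [hbin'] at hbin
  rw [hn] at htern
  have h := (multipartiteMap_equivalent_prod k (l + 2) t).trans ((hpart.trans ((hquat.trans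
    ((UnimodularlyEquivalent.refl _).prodMap (htern.trans
      ((UnimodularlyEquivalent.refl _).prodMap hbin)))).prodMap hshear)).prodMap (.refl _))
  refine h.trans ⟨blockCoordinates k l, blockCoordinates k l, fun x => ?_⟩
  ext (((((_ | _) | _) | _) | _) | _ | _)
  · exact (by simp : ∀ z : ℤ, z = ((1 : ℕ) : ℤ) * z) _
  · exact (by simp : ∀ z : ℤ, z = ((1 : ℕ) : ℤ) * z) _
  · rfl
  · rfl
  · exact (by simp : ∀ z : ℤ, ε * t * z = ((ε * t : ℕ) : ℤ) * z) _
  · exact (by simp [hτ] : ∀ z : ℤ,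
      t * (t - (k + 2)) * z = ((t * (t - (k + 2)) : ℕ) : ℤ) * z) _
  · refine (?_ : ∀ z : ℤ, ε * t * (s' * ((a * q - s') * n') - q * -(a * q - s')) * z =
      ((t * (t - (k + 2)) * (s' * n' + q) : ℕ) : ℤ) * z) _
    intro z
    rw [Nat.cast_mul, Nat.cast_mul, hτ]
    push_cast
    linear_combination -(t * (s' * n' + q) * z) * hw

theorem SimpleGraph.signlessTrsMatrix_hasSmithNormalForm {V : Type*} [Fintype V] [DecidableEq V]
    {G : SimpleGraph V} [DecidableRel G.Adj] {k l t a n' r' ε s' q : ℕ}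
    (φ : G ≃g completeEquipartiteGraph (l + 2) (k + 2)) (hreg : G.IsTransmissionRegular t)
    (hn : a * n' = l + 1) (hr : a * r' = 2 * (k + 1)) (hnr : n'.Coprime r')
    (hs : ε * s' = k + 2) (hq : ε * q = r' + (k + 2) * n') (hsq : s'.Coprime q)
    (ht : t = (l + 1) * (k + 2) + 2 * (k + 1)) :
    G.signlessTrsMatrix.HasSmithNormalForm
      (List.replicate (l + 1) 1 ++ [a] ++ List.replicate (k * (l + 2)) t ++ [ε * t] ++
        List.replicate l (t * (t - (k + 2))) ++ [t * (t - (k + 2)) * (s' * n' + q)]) := by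
  have hta : t = a * (ε * q) := by
    rw [hq, ht, ← hn, ← hr]
    ring
  have hε : ε ∣ t - (k + 2) := by
    refine Nat.dvd_sub ?_ (Dvd.intro _ hs)
    rw [hta]
    exact (Dvd.intro _ rfl : ε ∣ ε * q).mul_left a
  refine .of_unimodularlyEquivalent ?_ (isListing_invariantFactorLabel k l a t (ε * t)
    (t * (t - (k + 2))) (t * (t - (k + 2)) * (s' * n' + q)))
    ((signlessTrsMatrix_equivalent_multipartiteMap φ hreg).trans
      (multipartiteMap_equivalent_diagonal hn hr hnr hs hq hsq ht))
  refine isChain_dvd_invariantFactors (Dvd.intro _ hta.symm) (Dvd.intro_left _ rfl) ?_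
    (Dvd.intro _ rfl)
  rw [mul_comm ε]
  exact Nat.mul_dvd_mul_left t hε

/-! ### Parity and the final form -/

/-- The gcd divides both `2s` and `ar' = 2(s-1)`, hence 2. -/
theorem gcd_part_size_eq {k l a n' r' : ℕ} (hn : a * n' = l + 1) (hr : a * r' = 2 * (k + 1))
    (ha : a = Nat.gcd (l + 1) (2 * (k + 1))) :
    Nat.gcd (k + 2) (r' + (k + 2) * n') = if Even (l + 2) ∧ Even (k + 2) then 2 else 1 := by
  rw [Nat.gcd_add_mul_left_right]
  have htwo : Nat.gcd (k + 2) r' ∣ 2 := by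
    have h₁ : Nat.gcd (k + 2) r' ∣ 2 * (k + 2) := (Nat.gcd_dvd_left _ _).mul_left 2
    have h₂ : Nat.gcd (k + 2) r' ∣ 2 * (k + 1) := hr ▸ (Nat.gcd_dvd_right _ _).mul_left a
    simpa [show 2 * (k + 2) - 2 * (k + 1) = 2 by omega] using Nat.dvd_sub h₁ h₂
  split_ifs with h
  · refine Nat.dvd_antisymm htwo (Nat.dvd_gcd h.2.two_dvd ?_)
    have ha_odd : ¬ 2 ∣ a := fun h2 => by
      have := h2.trans (Dvd.intro _ hn)
      have := h.1.two_dvd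
      omega
    exact (Nat.prime_two.dvd_mul.1 (Dvd.intro _ hr.symm : 2 ∣ a * r')).resolve_left ha_odd
  · refine ((Nat.dvd_prime Nat.prime_two).1 htwo).resolve_right fun h2 => h ?_
    have hk : 2 ∣ k + 2 := h2.symm.dvd.trans (Nat.gcd_dvd_left _ _)
    have hr' : 2 ∣ r' := h2.symm.dvd.trans (Nat.gcd_dvd_right _ _)
    refine ⟨?_, even_iff_two_dvd.2 hk⟩
    by_contra hl
    have ha2 : 2 ∣ a := ha ▸ Nat.dvd_gcd (by rw [even_iff_two_dvd] at hl; omega) (Dvd.intro _ rfl)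
    -- Now 4 divides `2(s-1)`, although `s` is even.
    have := mul_dvd_mul ha2 hr'
    omega

theorem proposition4p7 {V : Type*} [Fintype V] [DecidableEq V]
    (G : SimpleGraph V) [DecidableRel G.Adj] (m s t : ℕ) (hm : 2 ≤ m) (hs : 2 ≤ s)
    (hG : Nonempty (G ≃g SimpleGraph.completeEquipartiteGraph m s))
    (ht : G.IsTransmissionRegular t) (a : ℕ) (ha : a = Nat.gcd (m - 1) (2 * (s - 1))) :
    ((Even m ∧ Even s) →
      a ∣ (m * s - 1) * (t * (t - s)) ∧
      G.signlessTrsMatrix.HasSmithNormalForm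
        (List.replicate (m - 1) 1 ++ [a] ++ List.replicate (m * s - 2 * m) t ++ [2 * t] ++
          List.replicate (m - 2) (t * (t - s)) ++ [(m * s - 1) * (t * (t - s)) / a])) ∧
    (¬ (Even m ∧ Even s) →
      a ∣ 2 * (m * s - 1) * (t * (t - s)) ∧
      G.signlessTrsMatrix.HasSmithNormalForm
        (List.replicate (m - 1) 1 ++ [a] ++ List.replicate (m * s - 2 * m) t ++ [t] ++
          List.replicate (m - 2) (t * (t - s)) ++ [2 * (m * s - 1) * (t * (t - s)) / a])) := by
  obtain ⟨φ⟩ := hG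
  obtain ⟨l, rfl⟩ := Nat.exists_eq_add_of_le' hm
  obtain ⟨k, rfl⟩ := Nat.exists_eq_add_of_le' hs
  rw [show l + 2 - 1 = l + 1 by omega, show k + 2 - 1 = k + 1 by omega] at ha
  have htrs := SimpleGraph.transmission_add_two_of_iso_completeEquipartiteGraph hm φ
    (φ.symm (0, 0))
  rw [ht] at htrs
  have ht' : t = (l + 1) * (k + 2) + 2 * (k + 1) := by linarith
  have ha0 : 0 < a := ha ▸ Nat.gcd_pos_of_pos_left _ (Nat.succ_pos l)
  obtain ⟨n', r', hnr, hn, hr⟩ := Nat.exists_coprime (l + 1) (2 * (k + 1))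
  rw [← ha, mul_comm _ a] at hn hr
  obtain ⟨s', q, hsq, hs', hq⟩ := Nat.exists_coprime (k + 2) (r' + (k + 2) * n')
  have hgcd := gcd_part_size_eq hn.symm hr.symm ha
  have hms : (l + 2) * (k + 2) - 1 = (l + 1) * (k + 2) + (k + 1) := by
    rw [Nat.sub_eq_iff_eq_add (by nlinarith)]
    ring
  have hcard : (l + 2) * (k + 2) - 2 * (l + 2) = k * (l + 2) := by
    rw [Nat.sub_eq_iff_eq_add (by nlinarith)]
    ring
  rw [hms, hcard, show l + 2 - 1 = l + 1 by omega, show l + 2 - 2 = l by omega]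
  have hsnf := SimpleGraph.signlessTrsMatrix_hasSmithNormalForm φ ht hn.symm hr.symm hnr
    (by rw [mul_comm]; exact hs'.symm) (by rw [mul_comm]; exact hq.symm) hsq ht'
  generalize Nat.gcd (k + 2) (r' + (k + 2) * n') = ε at *
  -- This identity, with right side `2(ms-1)`, makes the division by `a` exact in both cases.
  have hprod : a * (ε * (s' * n' + q)) = 2 * ((l + 1) * (k + 2) + (k + 1)) := by
    calc a * (ε * (s' * n' + q)) = a * ((s' * ε) * n' + q * ε) := by ring
      _ = a * ((k + 2) * n' + (r' + (k + 2) * n')) := by rw [← hs', ← hq]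
      _ = 2 * (a * n') * (k + 2) + a * r' := by ring
      _ = 2 * ((l + 1) * (k + 2) + (k + 1)) := by rw [← hn, ← hr]; ring
  refine ⟨fun h => ?_, fun h => ?_⟩
  · rw [if_pos h] at hgcd
    subst hgcd
    have hlast : ((l + 1) * (k + 2) + (k + 1)) * (t * (t - (k + 2))) =
        a * (t * (t - (k + 2)) * (s' * n' + q)) := by
      rw [show (l + 1) * (k + 2) + (k + 1) = a * (s' * n' + q) by linarith]
      ring
    rw [hlast, Nat.mul_div_cancel_left _ ha0]
    exact ⟨Dvd.intro _ rfl, hsnf⟩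
  · rw [if_neg h] at hgcd
    subst hgcd
    have hlast : 2 * ((l + 1) * (k + 2) + (k + 1)) * (t * (t - (k + 2))) =
        a * (t * (t - (k + 2)) * (s' * n' + q)) := by
      rw [← hprod]
      ring
    rw [hlast, Nat.mul_div_cancel_left _ ha0]
    rw [one_mul] at hsnf
    exact ⟨Dvd.intro _ rfl, hsnf⟩
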